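/- Let $\gamma>0$ and let $U\colon\mathbb R^3\to\mathbb R^3$ be a $C^1$, divergence-free vector field with $|U(y)|/|y|\to 0$ as $|y|\to\infty$ which is axisymmetric around the third axis, i.e. $U=U_r(r,z)\,\vec e_r+U_\theta(r,z)\,\vec e_\theta+U_z(r,z)\,\vec e_z$ in cylindrical coordinates (for instance, any $C^1$ axisymmetric self-similar velocity profile of the 3D incompressible Euler equations with similarity exponent $\gamma$ that is sublinear at infinity). Consider the meridional self-similar flow on $\{(r,z): r\ge 0\}$, $$\dot R=\gamma R+U_r(R,Z),\qquad \dot Z=\gamma Z+U_z(R,Z),$$ and for a set $D$ let $D(\tau)$ denote the set of time-$\tau$ positions of the trajectories which start in $D$ at time $0$. (i) Let $D\subset\{r>0\}$ be bounded and open. Then, for all $\tau\in\mathbb R$, $$\frac{d}{d\tau}\int_{D(\tau)} r\,dr\,dz=3\gamma\int_{D(\tau)} r\,dr\,dz,\qquad \int_{D(\tau)} r\,dr\,dz=e^{3\gamma\tau}\int_D r\,dr\,dz .$$ Consequently, if $\int_D r\,dr\,dz>0$, then $D$ is not invariant under the flow, i.e. it is not the case that $D(\tau)=D$ for all $\tau\in\mathbb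 R$. (ii) Assume that all fixed points of the meridional flow lie on the axis $\{r=0\}$. Then there is no heteroclinic and no homoclinic orbit passing through $\{r>0\}$: no trajectory $(R(\tau),Z(\tau))_{\tau\in\mathbb R}$ that meets $\{r>0\}$ converges to a fixed point as $\tau\to-\infty$ and to a fixed point (a different one or the same one) as $\tau\to+\infty$. -/

import Mathlib

open Filter Topology MeasureTheory

noncomputable section

/-- Three-dimensional Euclidean space. -/
abbrev E3 : Type := EuclideanSpace ℝ (Fin 3)

/-- The component `U_r(r,z)` of `U` along `e_r`, read off on the meridional half-plane `θ = 0`. -/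
def radialPart (U : E3 → E3) (r z : ℝ) : ℝ := U !₂[r, 0, z] 0

/-- The component `U_θ(r,z)` of `U` along `e_θ` (the swirl). -/
def swirlPart (U : E3 → E3) (r z : ℝ) : ℝ := U !₂[r, 0, z] 1

/-- The component `U_z(r,z)` of `U` along `e_z`. -/
def axialPart (U : E3 → E3) (r z : ℝ) : ℝ := U !₂[r, 0, z] 2

/-- `U` is axisymmetric around the third axis (swirl allowed):
`U(y) = U_r(r,z) e_r + U_θ(r,z) e_θ + U_z(r,z) e_z` for `y = (r cos θ, r sin θ, z)`, where
`e_r = (cos θ, sin θ, 0)`, `e_θ = (-sin θ, cos θ, 0)`, `e_z = (0, 0, 1)`. -/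
def IsAxisymmetric (U : E3 → E3) : Prop :=
  ∀ r θ z : ℝ, 0 ≤ r →
    U !₂[r * Real.cos θ, r * Real.sin θ, z] =
      radialPart U r z • (!₂[Real.cos θ, Real.sin θ, 0] : E3) +
      swirlPart U r z • (!₂[-Real.sin θ, Real.cos θ, 0] : E3) +
      axialPart U r z • (!₂[0, 0, 1] : E3)

/-- `∇ · U = 0` (used for differentiable `U`). -/
def IsDivergenceFree (U : E3 → E3) : Prop :=
  ∀ y : E3, ∑ i : Fin 3, (fderiv ℝ U y (EuclideanSpace.single i 1)) i = 0

/-- `|U(y)| / |y| → 0` as `|y| → ∞`. -/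
def IsSublinear (U : E3 → E3) : Prop :=
  Tendsto (fun y : E3 => ‖U y‖ / ‖y‖) (Bornology.cobounded E3) (𝓝 0)

/-- The meridional self-similar transport velocity `(γ r + U_r(r,z), γ z + U_z(r,z))` at
`p = (r, z)`. -/
def meridionalField (γ : ℝ) (U : E3 → E3) (p : ℝ × ℝ) : ℝ × ℝ :=
  (γ * p.1 + radialPart U p.1 p.2, γ * p.2 + axialPart U p.1 p.2)

/-- `c = (R, Z)` is a trajectory, for all times `τ ∈ ℝ`, of the meridional flow in the closed
half-plane `{r ≥ 0}`. -/
def IsMeridionalTrajectory (γ : ℝ) (U : E3 → E3) (c : ℝ → ℝ × ℝ) : Prop :=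
  (∀ τ, 0 ≤ (c τ).1) ∧ ∀ τ, HasDerivAt c (meridionalField γ U (c τ)) τ

/-- The advected region `D(τ) = {(R(r,z,τ), Z(r,z,τ)) : (r,z) ∈ D}`. -/
def advect (γ : ℝ) (U : E3 → E3) (D : Set (ℝ × ℝ)) (τ : ℝ) : Set (ℝ × ℝ) :=
  {q | ∃ c : ℝ → ℝ × ℝ, IsMeridionalTrajectory γ U c ∧ c 0 ∈ D ∧ c τ = q}

/-- `D` is invariant under the meridional flow: `D(τ) = D` for all `τ ∈ ℝ`. -/
def IsFlowInvariant (γ : ℝ) (U : E3 → E3) (D : Set (ℝ × ℝ)) : Prop :=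
  ∀ τ : ℝ, advect γ U D τ = D

/-- The weighted area `∫_D r dr dz`. -/
def weightedArea (D : Set (ℝ × ℝ)) : ℝ := ∫ p in D, p.1

/-- The open meridional half-plane `{r > 0}`. -/
def openHalfPlane : Set (ℝ × ℝ) := {p | 0 < p.1}

/-- Fixed points of the meridional flow in the closed half-plane. -/
def IsMeridionalFixedPoint (γ : ℝ) (U : E3 → E3) (p : ℝ × ℝ) : Prop :=
  0 ≤ p.1 ∧ meridionalField γ U p = 0

/-- `c` is a trajectory which converges to the fixed point `p` as `τ → -∞` and to the fixed point
`q` as `τ → +∞`. -/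
def Connects (γ : ℝ) (U : E3 → E3) (p q : ℝ × ℝ) (c : ℝ → ℝ × ℝ) : Prop :=
  IsMeridionalFixedPoint γ U p ∧ IsMeridionalFixedPoint γ U q ∧ IsMeridionalTrajectory γ U c ∧
    Tendsto c atBot (𝓝 p) ∧ Tendsto c atTop (𝓝 q)

/-- A heteroclinic orbit connects two distinct fixed points. -/
def IsHeteroclinic (γ : ℝ) (U : E3 → E3) (c : ℝ → ℝ × ℝ) : Prop :=
  ∃ p q, p ≠ q ∧ Connects γ U p q c

/-- A homoclinic orbit is a nonconstant trajectory connecting a fixed point to itself. -/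
def IsHomoclinic (γ : ℝ) (U : E3 → E3) (c : ℝ → ℝ × ℝ) : Prop :=
  ∃ p, Connects γ U p p c ∧ ∃ τ, c τ ≠ p

end

/-! ### Global flows of `C¹` fields of linear growth and their differentiability in the initial
point. -/

section Flow

open Set Metric
open scoped NNReal

variable {E : Type*} [NormedAddCommGroup E] [NormedSpace ℝ E]

/-! Incompressibility in axisymmetric form says that the meridional field `V` satisfies `∂_r (r V_r)
+ ∂_z (r V_z) = 3γ r`. By Liouville's formula, the Jacobian of the flow times the transported weight
`r` therefore grows exactly like `exp (3γτ)` (`det_mul_weight_eq`), and a change of variables turns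
this into the law for the weighted area. Sublinearity of `U` makes the flow global, and the
reflection symmetry of `V` keeps the axis, hence also `{r > 0}`, invariant. A set of positive finite
weighted area cannot be invariant, since the area would have to be multiplied by `exp (3γ) > 1` at
time 1.

For part (ii), a connecting orbit through `{r > 0}` stays there and has both ends on the axis. It is
a simple regular curve, so it cuts a bounded component off the half-plane
(`exists_bounded_connectedComponentIn`). Other orbits cannot cross it, so that component is
invariant; being open, bounded and nonempty it has positive weighted area, contradicting (i). The
Jordan-type separation is `Complex.not_joinedIn_of_crossing`, proved with continuous logarithms. -/

/-- `φ t x` is the position at time `t` of the integral curve of `V` which starts at `x`. -/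
structure IsFlow (V : E → E) (φ : ℝ → E → E) : Prop where
  init : ∀ x, φ 0 x = x
  hasDerivAt : ∀ t x, HasDerivAt (fun s => φ s x) (V (φ t x)) t

/-- A vector field of at most linear growth. -/
def HasLinearGrowth (V : E → E) : Prop :=
  ∃ C : ℝ, 0 < C ∧ ∀ x, ‖V x‖ ≤ C * (1 + ‖x‖)

variable {V : E → E} {φ : ℝ → E → E}

namespace IsFlow

theorem continuous_time (hφ : IsFlow V φ) (x : E) : Continuous fun t => φ t x :=
  continuous_iff_continuousAt.2 fun t => (hφ.hasDerivAt t x).continuousAt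

theorem reverse (hφ : IsFlow V φ) : IsFlow (fun x => -V x) fun t x => φ (-t) x where
  init x := by simp [hφ.init]
  hasDerivAt t x := by
    simpa [Function.comp_def] using (hφ.hasDerivAt (-t) x).scomp t (hasDerivAt_neg t)

theorem exists_norm_le (hφ : IsFlow V φ) (hg : HasLinearGrowth V) (M T : ℝ) :
    ∃ ρ, ∀ x, ‖x‖ ≤ M → ∀ t ∈ Icc 0 T, ‖φ t x‖ ≤ ρ := by
  obtain ⟨C, hC, hg⟩ := hg
  by_cases hM : 0 ≤ M
  · refine ⟨gronwallBound M C C T, fun x hx t ht => ?_⟩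
    have := norm_le_gronwallBound_of_norm_deriv_right_le (f := fun t => φ t x) (a := 0) (b := T)
      (hφ.continuous_time x).continuousOn
      (fun t _ => (hφ.hasDerivAt t x).hasDerivWithinAt) (by simpa [hφ.init] using hx)
      (K := C) (ε := C) (fun t _ => (hg _).trans_eq (by ring)) t ht
    exact this.trans (gronwallBound_mono hM hC.le hC.le (by simpa using ht.2))
  · exact ⟨0, fun x hx => absurd ((norm_nonneg x).trans hx) hM⟩

end IsFlow

variable [ProperSpace E]

theorem ContDiff.exists_lipschitzOnWith_closedBall (hV : ContDiff ℝ 1 V) (ρ : ℝ) :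
    ∃ K : ℝ≥0, 1 ≤ K ∧ LipschitzOnWith K V (closedBall 0 ρ) ∧
      ∀ x ∈ closedBall (0 : E) ρ, ‖fderiv ℝ V x‖ ≤ K := by
  obtain ⟨K, hK⟩ := (isCompact_closedBall (0 : E) ρ).exists_bound_of_continuousOn
    (hV.continuous_fderiv one_ne_zero).continuousOn
  have hb : ∀ x ∈ closedBall (0 : E) ρ, ‖fderiv ℝ V x‖ ≤ (max 1 K.toNNReal : ℝ≥0) := fun x hx =>
    (hK x hx).trans ((Real.le_coe_toNNReal K).trans (NNReal.coe_le_coe.2 (le_max_right _ _)))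
  exact ⟨max 1 K.toNNReal, le_max_left _ _,
    (convex_closedBall 0 ρ).lipschitzOnWith_of_nnnorm_fderiv_le
      (fun x _ => hV.differentiable one_ne_zero x) (fun x hx => hb x hx), hb⟩

/-- `V` is only Lipschitz on balls, so both curves are first confined to one ball over a bounded
time window containing `t` and `t₀`. -/
theorem integralCurve_unique (hV : ContDiff ℝ 1 V) {c d : ℝ → E}
    (hc : ∀ t, HasDerivAt c (V (c t)) t) (hd : ∀ t, HasDerivAt d (V (d t)) t) {t₀ : ℝ}
    (h : c t₀ = d t₀) : c = d := by
  ext t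
  obtain ⟨A, B, ht, ht₀⟩ : ∃ A B, t ∈ Ioo A B ∧ t₀ ∈ Ioo A B := by
    use (min (-|t|) (-|t₀|) - 1), (max |t| |t₀| + 1)
    grind
  have hcc : Continuous c := continuous_iff_continuousAt.2 fun t => (hc t).continuousAt
  have hdc : Continuous d := continuous_iff_continuousAt.2 fun t => (hd t).continuousAt
  obtain ⟨r₁, h₁⟩ := isCompact_Icc.exists_bound_of_continuousOn (hcc.continuousOn (s := Icc A B))
  obtain ⟨r₂, h₂⟩ := isCompact_Icc.exists_bound_of_continuousOn (hdc.continuousOn (s := Icc A B))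
  obtain ⟨K, -, hK, -⟩ := hV.exists_lipschitzOnWith_closedBall (max r₁ r₂)
  refine ODE_solution_unique_of_mem_Ioo (v := fun _ => V) (s := fun _ => closedBall 0 (max r₁ r₂))
    (fun _ _ => hK) ht₀ (fun s hs => ⟨hc s, ?_⟩) (fun s hs => ⟨hd s, ?_⟩) h ht
  · simpa using Or.inl (h₁ s (Ioo_subset_Icc_self hs))
  · simpa using Or.inr (h₂ s (Ioo_subset_Icc_self hs))

-- On the ball of radius `‖y‖ + 1` about `y`, linear growth bounds `V` by `2C(‖y‖ + 1)`. The
-- Picard–Lindelöf time is thus `1 / (2C)` for every `y`, and a uniform existence time gives global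
-- curves.
open scoped Manifold in
theorem exists_isFlow (hV : ContDiff ℝ 1 V) (hg : HasLinearGrowth V) : ∃ φ, IsFlow V φ := by
  obtain ⟨C, hC, hg⟩ := hg
  have key : ∀ x : E, ∃ c : ℝ → E, c 0 = x ∧ ∀ t, HasDerivAt c (V (c t)) t := by
    intro x
    have hV' : CMDiff 1 (fun x : E ↦ (⟨x, V x⟩ : TangentBundle 𝓘(ℝ, E) E)) :=
      contMDiff_vectorSpace_iff_contDiff.2 hV
    have := exists_isMIntegralCurve_of_isMIntegralCurveOn (I := 𝓘(ℝ, E)) hV' (ε := 1 / (2 * C))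
      (by positivity) ?_ x
    · obtain ⟨c, h0, hc⟩ := this
      refine ⟨c, h0, fun t => ?_⟩
      have h : HasFDerivAt c ((1 : ℝ →L[ℝ] ℝ).smulRight (V (c t))) t :=
        hasMFDerivAt_iff_hasFDerivAt.1 (hc t)
      simpa using h.hasDerivAt
    · intro y
      obtain ⟨K, -, hK, -⟩ := hV.exists_lipschitzOnWith_closedBall (2 * ‖y‖ + 1)
      have hsub : closedBall y (‖y‖ + 1) ⊆ closedBall 0 (2 * ‖y‖ + 1) := by
        refine closedBall_subset_closedBall' ?_
        rw [dist_zero_right]; linarith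
      have hpos : (0 : ℝ) < 1 / (2 * C) := by positivity
      have hPL : IsPicardLindelof (fun _ => V) (tmin := -(1 / (2 * C))) (tmax := 1 / (2 * C))
          ⟨0, by constructor <;> linarith⟩ y (‖y‖₊ + 1) 0 ((2 * C * (‖y‖ + 1)).toNNReal) K := by
        refine .of_time_independent (fun z hz => ?_) (hK.mono (by simpa using hsub)) ?_
        · have : ‖z‖ ≤ 2 * ‖y‖ + 1 := by simpa using hsub (by simpa using hz)
          rw [Real.coe_toNNReal _ (by positivity)]
          nlinarith [hg z]
        · rw [Real.coe_toNNReal _ (by positivity)]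
          simp
          field_simp
          norm_num
      obtain ⟨c, h0, hc⟩ := hPL.exists_eq_forall_mem_Icc_hasDerivWithinAt₀
      refine ⟨c, h0, fun t ht => ?_⟩
      have := (hc t (Ioo_subset_Icc_self ht)).hasDerivAt (Icc_mem_nhds ht.1 ht.2)
      exact (hasMFDerivAt_iff_hasFDerivAt.2 this.hasFDerivAt).hasMFDerivWithinAt
  choose c h0 hc using key
  exact ⟨fun t x => c x t, h0, fun t x => hc x t⟩

namespace IsFlow

theorem eq_of_hasDerivAt (hφ : IsFlow V φ) (hV : ContDiff ℝ 1 V) {c : ℝ → E}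
    (hc : ∀ t, HasDerivAt c (V (c t)) t) (t : ℝ) : c t = φ t (c 0) :=
  congrFun (integralCurve_unique hV hc (fun t => hφ.hasDerivAt t (c 0)) (t₀ := 0)
    (hφ.init _).symm) t

theorem add (hφ : IsFlow V φ) (hV : ContDiff ℝ 1 V) (s t : ℝ) (x : E) :
    φ (s + t) x = φ s (φ t x) := by
  have := hφ.eq_of_hasDerivAt hV (c := fun s => φ (s + t) x)
    (fun s => (hφ.hasDerivAt (s + t) x).comp_add_const s t) s
  simpa using this

theorem neg_apply_self (hφ : IsFlow V φ) (hV : ContDiff ℝ 1 V) (t : ℝ) (x : E) :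
    φ (-t) (φ t x) = x := by
  rw [← hφ.add hV, neg_add_cancel, hφ.init]

theorem self_apply_neg (hφ : IsFlow V φ) (hV : ContDiff ℝ 1 V) (t : ℝ) (x : E) :
    φ t (φ (-t) x) = x := by
  rw [← hφ.add hV, add_neg_cancel, hφ.init]

theorem injective (hφ : IsFlow V φ) (hV : ContDiff ℝ 1 V) (t : ℝ) : Function.Injective (φ t) :=
  Function.LeftInverse.injective (hφ.neg_apply_self hV t)

theorem image_eq_preimage (hφ : IsFlow V φ) (hV : ContDiff ℝ 1 V) (t : ℝ) (D : Set E) :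
    φ t '' D = φ (-t) ⁻¹' D :=
  congrFun (image_eq_preimage_of_inverse (hφ.neg_apply_self hV t) (hφ.self_apply_neg hV t)) D

theorem exists_lipschitz (hφ : IsFlow V φ) (hV : ContDiff ℝ 1 V) (hg : HasLinearGrowth V)
    (M T : ℝ) : ∃ K : ℝ, 1 ≤ K ∧ ∀ x y, ‖x‖ ≤ M → ‖y‖ ≤ M → ∀ t ∈ Icc 0 T,
      ‖φ t x - φ t y‖ ≤ K * ‖x - y‖ := by
  obtain ⟨ρ, hρ⟩ := hφ.exists_norm_le hg M T
  obtain ⟨K, -, hK, -⟩ := hV.exists_lipschitzOnWith_closedBall ρ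
  refine ⟨Real.exp (K * |T|), Real.one_le_exp (by positivity), fun x y hx hy t ht => ?_⟩
  have := dist_le_of_trajectories_ODE_of_mem (v := fun _ => V) (s := fun _ => closedBall 0 ρ)
    (K := K) (f := fun t => φ t x) (g := fun t => φ t y) (a := 0) (b := T) (δ := ‖x - y‖)
    (fun _ _ => hK) (hφ.continuous_time x).continuousOn
    (fun t _ => (hφ.hasDerivAt t x).hasDerivWithinAt)
    (fun t ht => by simpa using hρ x hx t (Ico_subset_Icc_self ht))
    (hφ.continuous_time y).continuousOn
    (fun t _ => (hφ.hasDerivAt t y).hasDerivWithinAt)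
    (fun t ht => by simpa using hρ y hy t (Ico_subset_Icc_self ht))
    (by simp [hφ.init, dist_eq_norm]) t ht
  rw [dist_eq_norm] at this
  rw [mul_comm]
  refine this.trans ?_
  gcongr
  simpa using ht.2.trans (le_abs_self T)

theorem continuous_of_nonneg (hφ : IsFlow V φ) (hV : ContDiff ℝ 1 V) (hg : HasLinearGrowth V)
    {t : ℝ} (ht : 0 ≤ t) : Continuous (φ t) := by
  refine continuous_iff_continuousAt.2 fun x => ?_
  obtain ⟨K, -, hK⟩ := hφ.exists_lipschitz hV hg (‖x‖ + 1) t
  have : LipschitzOnWith K.toNNReal (φ t) (closedBall 0 (‖x‖ + 1)) :=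
    LipschitzOnWith.of_dist_le_mul fun y hy z hz => by
      rw [dist_eq_norm, dist_eq_norm]
      refine (hK y z (by simpa using hy) (by simpa using hz) t ⟨ht, le_rfl⟩).trans ?_
      gcongr
      exact Real.le_coe_toNNReal K
  refine this.continuousOn.continuousAt (mem_of_superset (ball_mem_nhds x one_pos) ?_)
  refine ball_subset_closedBall.trans (closedBall_subset_closedBall' ?_)
  rw [dist_zero_right]; linarith

theorem continuous (hφ : IsFlow V φ) (hV : ContDiff ℝ 1 V) (hg : HasLinearGrowth V)
    (t : ℝ) : Continuous (φ t) := by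
  rcases le_total 0 t with ht | ht
  · exact hφ.continuous_of_nonneg hV hg ht
  · have hg' : HasLinearGrowth fun x => -V x := by simpa [HasLinearGrowth] using hg
    simpa using hφ.reverse.continuous_of_nonneg hV.neg hg' (neg_nonneg.2 ht)

theorem isOpen_image (hφ : IsFlow V φ) (hV : ContDiff ℝ 1 V) (hg : HasLinearGrowth V)
    (t : ℝ) {D : Set E} (hD : IsOpen D) : IsOpen (φ t '' D) := by
  rw [hφ.image_eq_preimage hV]
  exact hD.preimage (hφ.continuous hV hg _)

/-- For short positive times, the flow is differentiable in the initial condition, and its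
derivative solves the linearized equation. -/
theorem exists_hasFDerivAt (hφ : IsFlow V φ) (hV : ContDiff ℝ 1 V) (hg : HasLinearGrowth V)
    (M : ℝ) : ∃ δ > 0, ∀ x, ‖x‖ ≤ M → ∃ Y : ℝ → E →L[ℝ] E, Y 0 = ContinuousLinearMap.id ℝ E ∧
      ∀ t ∈ Icc 0 δ, HasDerivWithinAt Y ((fderiv ℝ V (φ t x)).comp (Y t)) (Icc 0 δ) t ∧
        HasFDerivAt (φ t) (Y t) x := by
  obtain ⟨ρ, hρ⟩ := hφ.exists_norm_le hg (M + 1) 1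
  obtain ⟨K, hK1, -, hK⟩ := hV.exists_lipschitzOnWith_closedBall ρ
  obtain ⟨K₂, hK₂1, hK₂⟩ := hφ.exists_lipschitz hV hg (M + 1) 1
  have hK1' : (1 : ℝ) ≤ K := by exact_mod_cast hK1
  have hδ : (0 : ℝ) < 1 / (2 * K) := by positivity
  have hδ1 : 1 / (2 * (K : ℝ)) ≤ 1 := by
    rw [div_le_one (by positivity)]; linarith
  have hfc : Continuous (fderiv ℝ V) := hV.continuous_fderiv one_ne_zero
  -- Within distance 1 of the identity `‖A‖ ≤ 2`, so the linearized field is at most `2K` and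
  -- Picard–Lindelöf works up to time `1 / (2K)`. This depends on `M` only, which later allows
  -- iteration.
  refine ⟨1 / (2 * K), hδ, fun x hx => ?_⟩
  have hAK : ∀ t ∈ Icc (0 : ℝ) (1 / (2 * K)), ‖fderiv ℝ V (φ t x)‖ ≤ K := fun t ht =>
    hK _ (by simpa using hρ x (by linarith) t ⟨ht.1, ht.2.trans hδ1⟩)
  have hPL : IsPicardLindelof (fun t (A : E →L[ℝ] E) => (fderiv ℝ V (φ t x)).comp A)
      (tmin := 0) (tmax := 1 / (2 * K)) ⟨0, by constructor <;> linarith⟩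
      (ContinuousLinearMap.id ℝ E) 1 0 (2 * K) K := by
    refine ⟨fun t ht => ?_, fun A _ => ?_, fun t ht A hA => ?_, ?_⟩
    · refine LipschitzOnWith.of_dist_le_mul fun A _ B _ => ?_
      rw [dist_eq_norm, dist_eq_norm, ← ContinuousLinearMap.comp_sub]
      exact (ContinuousLinearMap.opNorm_comp_le _ _).trans (by gcongr; exact hAK t ht)
    · exact ((hfc.comp (hφ.continuous_time x)).clm_comp continuous_const).continuousOn
    · have hA' : ‖A‖ ≤ 2 := by
        have h1 : ‖A - ContinuousLinearMap.id ℝ E‖ ≤ 1 := by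
          rw [← dist_eq_norm]; simpa using hA
        have h2 := ContinuousLinearMap.norm_id_le (𝕜 := ℝ) (E := E)
        have h3 := norm_le_norm_sub_add A (ContinuousLinearMap.id ℝ E)
        linarith
      refine (ContinuousLinearMap.opNorm_comp_le _ _).trans ?_
      push_cast
      rw [mul_comm]
      gcongr
      exact hAK t ht
    · simp
      field_simp
      norm_num
  obtain ⟨Y, hY0, hY⟩ := hPL.exists_eq_forall_mem_Icc_hasDerivWithinAt₀
  refine ⟨Y, hY0, fun t ht => ⟨hY t ht, ?_⟩⟩
  rw [hasFDerivAt_iff_isLittleO, Asymptotics.isLittleO_iff]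
  intro ε' hε'
  -- Chosen to absorb the Lipschitz constant `K₂` of the flow and the Grönwall factor, which is at
  -- most `exp K`.
  set ε : ℝ := ε' / (K₂ * Real.exp K) with hε
  have hεpos : 0 < ε := by positivity
  obtain ⟨η, hη, hunif⟩ := Metric.uniformContinuousOn_iff.1
    ((isCompact_closedBall (0 : E) ρ).uniformContinuousOn_of_continuous hfc.continuousOn) ε hεpos
  have hr : 0 < min 1 (η / K₂) := by positivity
  filter_upwards [ball_mem_nhds x hr] with y hy
  rw [mem_ball, dist_eq_norm, lt_min_iff, lt_div_iff₀ (by positivity)] at hy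
  have hyM : ‖y‖ ≤ M + 1 := by
    have := norm_le_norm_sub_add y x
    linarith [hy.1]
  have hyd : ∀ s ∈ Icc (0 : ℝ) 1, ‖φ s y - φ s x‖ ≤ K₂ * ‖y - x‖ := fun s hs =>
    hK₂ y x hyM (by linarith) s hs
  have hlin : ∀ s ∈ Icc (0 : ℝ) 1,
      ‖V (φ s y) - V (φ s x) - fderiv ℝ V (φ s x) (φ s y - φ s x)‖ ≤ ε * (K₂ * ‖y - x‖) := by
    intro s hs
    have hbx : φ s x ∈ closedBall (0 : E) ρ := by simpa using hρ x (by linarith) s hs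
    have hby : φ s y ∈ closedBall (0 : E) ρ := by simpa using hρ y hyM s hs
    have := Convex.norm_image_sub_le_of_norm_fderiv_le' (𝕜 := ℝ) (f := V) (C := ε)
      (s := closedBall 0 ρ ∩ ball (φ s x) η) (x := φ s x) (y := φ s y) (φ := fderiv ℝ V (φ s x))
      (fun z _ => hV.differentiable one_ne_zero z)
      (fun z hz => by
        rw [← dist_eq_norm]
        exact (hunif z hz.1 _ hbx hz.2).le)
      ((convex_closedBall _ _).inter (convex_ball _ _)) ⟨hbx, mem_ball_self hη⟩
      ⟨hby, by rw [mem_ball, dist_eq_norm]; linarith [hyd s hs, hy.2]⟩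
    refine this.trans ?_
    gcongr
    exact hyd s hs
  -- The increment `φ s y - φ s x` solves the linearized equation up to the error `hlin`, while `Y s
  -- (y - x)` solves it exactly from the same initial value; Grönwall compares them.
  have hG := dist_le_of_approx_trajectories_ODE_of_mem (K := K) (a := 0) (b := 1 / (2 * K))
    (v := fun s z => fderiv ℝ V (φ s x) z) (s := fun _ => univ)
    (f := fun s => φ s y - φ s x) (f' := fun s => V (φ s y) - V (φ s x))
    (g := fun s => Y s (y - x)) (g' := fun s => fderiv ℝ V (φ s x) (Y s (y - x)))
    (εf := ε * (K₂ * ‖y - x‖)) (εg := 0) (δ := 0)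
    (fun s hs => (((fderiv ℝ V (φ s x)).lipschitz).weaken
      (hAK s (Ico_subset_Icc_self hs))).lipschitzOnWith)
    ((hφ.continuous_time y).sub (hφ.continuous_time x)).continuousOn
    (fun s _ => ((hφ.hasDerivAt s y).sub (hφ.hasDerivAt s x)).hasDerivWithinAt)
    (fun s hs => by
      rw [dist_eq_norm]
      exact hlin s ⟨hs.1, hs.2.le.trans hδ1⟩)
    (fun _ _ => mem_univ _)
    (fun s hs => ((hY s hs).continuousWithinAt).clm_apply continuousWithinAt_const)
    (fun s hs => by
      have h1 := ((hY s (Ico_subset_Icc_self hs)).mono_of_mem_nhdsWithin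
        (Icc_mem_nhdsGE_of_mem hs)).clm_apply (hasDerivWithinAt_const s (Ici s) (y - x))
      simpa using h1)
    (fun s _ => by simp)
    (fun _ _ => mem_univ _)
    (by simp [hφ.init, hY0]) t ht
  rw [dist_eq_norm, gronwallBound_of_K_ne_0 (by positivity)] at hG
  refine hG.trans ?_
  simp only [zero_mul, zero_add, add_zero, sub_zero]
  have hexp : Real.exp (K * t) - 1 ≤ Real.exp K := by
    have : Real.exp (K * t) ≤ Real.exp K :=
      Real.exp_le_exp.2 (mul_le_of_le_one_right K.2 (ht.2.trans hδ1))
    linarith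
  have hexp0 : 0 ≤ Real.exp (K * t) - 1 :=
    sub_nonneg.2 (Real.one_le_exp (mul_nonneg K.2 ht.1))
  calc ε * (K₂ * ‖y - x‖) / K * (Real.exp (K * t) - 1)
      ≤ ε * (K₂ * ‖y - x‖) / 1 * Real.exp K := by gcongr
    _ = ε' * ‖y - x‖ := by rw [hε]; field_simp

end IsFlow

end Flow

/-! ### The meridional field: regularity, growth, symmetry, divergence and Liouville's formula. -/

section Meridional

open Set

/-- The inclusion `(r, z) ↦ (r, 0, z)` of the meridional plane `θ = 0`. -/
noncomputable def meridionalInclusion : ℝ × ℝ →L[ℝ] E3 :=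
  (ContinuousLinearMap.fst ℝ ℝ ℝ).smulRight (EuclideanSpace.single 0 1) +
    (ContinuousLinearMap.snd ℝ ℝ ℝ).smulRight (EuclideanSpace.single 2 1)

theorem meridionalInclusion_apply (p : ℝ × ℝ) : meridionalInclusion p = !₂[p.1, 0, p.2] := by
  ext i
  fin_cases i <;> simp [meridionalInclusion]

/-- The derivative of the meridional field. -/
noncomputable def meridionalFDeriv (γ : ℝ) (U : E3 → E3) (p : ℝ × ℝ) : ℝ × ℝ →L[ℝ] ℝ × ℝ :=
  γ • ContinuousLinearMap.id ℝ (ℝ × ℝ) +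
    (((EuclideanSpace.proj 0 : E3 →L[ℝ] ℝ).prod (EuclideanSpace.proj 2 : E3 →L[ℝ] ℝ)).comp
      ((fderiv ℝ U (meridionalInclusion p)).comp meridionalInclusion))

variable {γ : ℝ} {U : E3 → E3}

theorem meridionalField_eq (γ : ℝ) (U : E3 → E3) : meridionalField γ U = fun p => γ • p +
    ((EuclideanSpace.proj 0 : E3 →L[ℝ] ℝ).prod (EuclideanSpace.proj 2 : E3 →L[ℝ] ℝ))
      (U (meridionalInclusion p)) := by
  ext p <;> simp [meridionalField, radialPart, axialPart, meridionalInclusion_apply]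

theorem contDiff_meridionalField (γ : ℝ) (hU : ContDiff ℝ 1 U) :
    ContDiff ℝ 1 (meridionalField γ U) := by
  rw [meridionalField_eq]
  exact (contDiff_id.const_smul γ).add ((ContinuousLinearMap.contDiff _).comp
    (hU.comp meridionalInclusion.contDiff))

theorem fderiv_meridionalField (γ : ℝ) (hU : ContDiff ℝ 1 U) (p : ℝ × ℝ) :
    fderiv ℝ (meridionalField γ U) p = meridionalFDeriv γ U p := by
  rw [meridionalField_eq]
  refine HasFDerivAt.fderiv (((hasFDerivAt_id p).const_smul γ).add ?_)
  exact (ContinuousLinearMap.hasFDerivAt _).comp p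
    (((hU.differentiable one_ne_zero _).hasFDerivAt).comp p meridionalInclusion.hasFDerivAt)

theorem IsSublinear.exists_norm_le (hsub : IsSublinear U) (hU : Continuous U) :
    ∃ C : ℝ, 0 < C ∧ ∀ y, ‖U y‖ ≤ C * (1 + ‖y‖) := by
  have h1 : ∀ᶠ y in Bornology.cobounded E3, ‖U y‖ / ‖y‖ < 1 := hsub.eventually_lt_const one_pos
  obtain ⟨ρ, -, hρ⟩ := (Metric.hasBasis_cobounded_compl_closedBall (0 : E3)).eventually_iff.1 h1
  obtain ⟨C, hC⟩ := (isCompact_closedBall (0 : E3) (max ρ 0)).exists_bound_of_continuousOn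
    hU.continuousOn
  refine ⟨|C| + 1, by positivity, fun y => ?_⟩
  have hy0 := norm_nonneg y
  by_cases hy : y ∈ Metric.closedBall (0 : E3) (max ρ 0)
  · have := (hC y hy).trans (le_abs_self C)
    nlinarith [abs_nonneg C]
  · rw [mem_closedBall_zero_iff, not_le, max_lt_iff] at hy
    have h := hρ (x := y) (by simpa using hy.1)
    rw [div_lt_one hy.2] at h
    nlinarith [abs_nonneg C]

theorem hasLinearGrowth_meridionalField (γ : ℝ) (hU : Continuous U) (hsub : IsSublinear U) :
    HasLinearGrowth (meridionalField γ U) := by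
  obtain ⟨C, hC, h⟩ := hsub.exists_norm_le hU
  refine ⟨|γ| + C * (1 + ‖meridionalInclusion‖), by positivity, fun p => ?_⟩
  have hp := norm_nonneg p
  have hι := norm_nonneg meridionalInclusion
  have h1 : ‖U (meridionalInclusion p)‖ ≤ C * (1 + ‖meridionalInclusion‖) * (1 + ‖p‖) := by
    refine (h _).trans ?_
    rw [mul_assoc]
    gcongr
    nlinarith [meridionalInclusion.le_opNorm p]
  rw [meridionalField_eq]
  refine (norm_add_le _ _).trans ?_
  rw [norm_smul, Real.norm_eq_abs, add_mul]
  gcongr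
  · linarith
  · refine le_trans ?_ h1
    rw [Prod.norm_def]
    exact max_le (PiLp.norm_apply_le _ _) (PiLp.norm_apply_le _ _)

/-- This is axisymmetry at `θ = π`. The formula for the field makes sense on all of `ℝ × ℝ`, so the
flow can be studied in the whole plane and the axis treated as a mirror. -/
theorem IsAxisymmetric.meridionalField_reflect (haxi : IsAxisymmetric U) (γ r z : ℝ) :
    meridionalField γ U (-r, z) =
      (-(meridionalField γ U (r, z)).1, (meridionalField γ U (r, z)).2) := by
  have key : ∀ r, 0 ≤ r → meridionalField γ U (-r, z) =
      (-(meridionalField γ U (r, z)).1, (meridionalField γ U (r, z)).2) := by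
    intro r hr
    have h := haxi r Real.pi z hr
    simp only [Real.cos_pi, Real.sin_pi, mul_neg, mul_one, mul_zero] at h
    ext
    · simp [meridionalField, radialPart, h]
      ring
    · simp [meridionalField, axialPart, h]
  rcases le_total 0 r with hr | hr
  · exact key r hr
  · have h := key (-r) (by linarith)
    rw [neg_neg] at h
    rw [h]
    simp

/-- The divergence constraint in the meridional variables. -/
theorem IsDivergenceFree.meridionalFDeriv_trace (hdiv : IsDivergenceFree U)
    (haxi : IsAxisymmetric U) (hU : ContDiff ℝ 1 U) (γ : ℝ) {p : ℝ × ℝ} (hp : 0 < p.1) :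
    p.1 * ((meridionalFDeriv γ U p (1, 0)).1 + (meridionalFDeriv γ U p (0, 1)).2) +
      (meridionalField γ U p).1 = 3 * γ * p.1 := by
  obtain ⟨r, z⟩ := p
  have h1 : (meridionalFDeriv γ U (r, z) (1, 0)).1 =
      γ + fderiv ℝ U (meridionalInclusion (r, z)) (EuclideanSpace.single 0 1) 0 := by
    simp [meridionalFDeriv, meridionalInclusion]
  have h2 : (meridionalFDeriv γ U (r, z) (0, 1)).2 =
      γ + fderiv ℝ U (meridionalInclusion (r, z)) (EuclideanSpace.single 2 1) 2 := by
    simp [meridionalFDeriv, meridionalInclusion]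
  have hd := hdiv (meridionalInclusion (r, z))
  rw [Fin.sum_univ_three] at hd
  -- The remaining term `∂₂U₂` equals `U_r / r`: differentiate the second component of `U` along the
  -- circle around the axis, whose velocity at `θ = 0` is `r e₂`, and compare with the axisymmetric
  -- formula.
  have hcurve : HasDerivAt
      (fun θ : ℝ => (!₂[r * Real.cos θ, r * Real.sin θ, z] : E3))
      (r • EuclideanSpace.single 1 1) 0 := by
    have h := ((((Real.hasDerivAt_cos 0).const_mul r).smul_const
      (EuclideanSpace.single 0 1 : E3)).fun_add (((Real.hasDerivAt_sin 0).const_mul r).smul_const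
        (EuclideanSpace.single 1 1 : E3))).add_const (z • (EuclideanSpace.single 2 1 : E3))
    convert! h using 1
    · ext θ i
      fin_cases i <;> simp
    · simp
  have hpt : (!₂[r * Real.cos 0, r * Real.sin 0, z] : E3) = meridionalInclusion (r, z) := by
    simp [meridionalInclusion_apply]
  have hUc : HasDerivAt (fun θ : ℝ => U !₂[r * Real.cos θ, r * Real.sin θ, z])
      (fderiv ℝ U (meridionalInclusion (r, z)) (r • EuclideanSpace.single 1 1)) 0 := by
    have := (hU.differentiable one_ne_zero (meridionalInclusion (r, z))).hasFDerivAt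
    rw [← hpt] at this ⊢
    exact this.comp_hasDerivAt 0 hcurve
  have hUc1 : HasDerivAt (fun θ : ℝ => U !₂[r * Real.cos θ, r * Real.sin θ, z] 1) _ 0 :=
    (EuclideanSpace.proj 1 : E3 →L[ℝ] ℝ).hasFDerivAt.comp_hasDerivAt 0 hUc
  have hswirl : HasDerivAt (fun θ : ℝ => radialPart U r z * Real.sin θ +
      swirlPart U r z * Real.cos θ) (radialPart U r z) 0 := by
    simpa using ((Real.hasDerivAt_sin 0).const_mul (radialPart U r z)).fun_add
      ((Real.hasDerivAt_cos 0).const_mul (swirlPart U r z))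
  have heq : (fun θ : ℝ => U !₂[r * Real.cos θ, r * Real.sin θ, z] 1) =
      fun θ : ℝ => radialPart U r z * Real.sin θ + swirlPart U r z * Real.cos θ := by
    ext θ
    rw [haxi r θ z hp.le]
    simp
  rw [heq] at hUc1
  have h3 := hUc1.unique hswirl
  simp only [map_smul, PiLp.proj_apply, smul_eq_mul] at h3
  rw [h1, h2]
  simp only [meridionalField]
  linear_combination r * hd - h3

theorem ContinuousLinearMap.det_prod_real (A : ℝ × ℝ →L[ℝ] ℝ × ℝ) :
    A.det = (A (1, 0)).1 * (A (0, 1)).2 - (A (0, 1)).1 * (A (1, 0)).2 := by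
  rw [ContinuousLinearMap.det, ← LinearMap.det_toMatrix (Module.Basis.finTwoProd ℝ),
    Matrix.det_fin_two]
  simp [LinearMap.toMatrix_apply]

theorem ContinuousLinearMap.apply_prod_real (A : ℝ × ℝ →L[ℝ] ℝ × ℝ) (v : ℝ × ℝ) :
    A v = v.1 • A (1, 0) + v.2 • A (0, 1) := by
  rw [← map_smul, ← map_smul, ← map_add]
  simp

/-- Liouville's formula, combined with the evolution of the weight. -/
theorem det_mul_weight_eq {A Y : ℝ → ℝ × ℝ →L[ℝ] ℝ × ℝ} {R R' : ℝ → ℝ} {κ δ : ℝ}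
    (hY0 : Y 0 = ContinuousLinearMap.id ℝ (ℝ × ℝ))
    (hY : ∀ t ∈ Icc 0 δ, HasDerivWithinAt Y ((A t).comp (Y t)) (Icc 0 δ) t)
    (hR : ∀ t, HasDerivAt R (R' t) t)
    (h : ∀ t, R t * ((A t (1, 0)).1 + (A t (0, 1)).2) + R' t = κ * R t) :
    ∀ t ∈ Icc 0 δ, (Y t).det * R t = Real.exp (κ * t) * R 0 := by
  have hcol : ∀ v, ∀ t ∈ Icc 0 δ,
      HasDerivWithinAt (fun s => Y s v) (A t (Y t v)) (Icc 0 δ) t := fun v t ht => by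
    simpa using (hY t ht).clm_apply (hasDerivWithinAt_const t (Icc 0 δ) v)
  have hfst : ∀ v, ∀ t ∈ Icc 0 δ,
      HasDerivWithinAt (fun s => (Y s v).1) (A t (Y t v)).1 (Icc 0 δ) t := fun v t ht =>
    (ContinuousLinearMap.fst ℝ ℝ ℝ).hasFDerivAt.comp_hasDerivWithinAt t (hcol v t ht)
  have hsnd : ∀ v, ∀ t ∈ Icc 0 δ,
      HasDerivWithinAt (fun s => (Y s v).2) (A t (Y t v)).2 (Icc 0 δ) t := fun v t ht =>
    (ContinuousLinearMap.snd ℝ ℝ ℝ).hasFDerivAt.comp_hasDerivWithinAt t (hcol v t ht)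
  have hexp : ∀ t, HasDerivAt (fun s => Real.exp (-(κ * s))) (Real.exp (-(κ * t)) * -κ) t :=
    fun t => by simpa using (((hasDerivAt_id t).const_mul κ).neg).exp
  -- Since `(det Y)' = tr A · det Y`, this derivative is `det Y · exp (-κt) · (R tr A + R' - κR)`,
  -- which vanishes by `h`.
  have hder : ∀ t ∈ Icc 0 δ, HasDerivWithinAt
      (fun s => (Y s).det * R s * Real.exp (-(κ * s))) 0 (Icc 0 δ) t := by
    intro t ht
    simp only [ContinuousLinearMap.det_prod_real]
    refine ((((hfst (1, 0) t ht).fun_mul (hsnd (0, 1) t ht)).fun_sub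
      ((hfst (0, 1) t ht).fun_mul (hsnd (1, 0) t ht))).fun_mul (hR t).hasDerivWithinAt |>.fun_mul
        (hexp t).hasDerivWithinAt).congr_deriv ?_
    rw [(A t).apply_prod_real (Y t (1, 0)), (A t).apply_prod_real (Y t (0, 1))]
    simp only [Prod.fst_add, Prod.snd_add, Prod.smul_fst, Prod.smul_snd, smul_eq_mul]
    linear_combination (((Y t (1, 0)).1 * (Y t (0, 1)).2 - (Y t (0, 1)).1 * (Y t (1, 0)).2) *
      Real.exp (-(κ * t))) * h t
  intro t ht
  have hconst := constant_of_has_deriv_right_zero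
    (fun s hs => (hder s hs).continuousWithinAt)
    (fun s hs => (hder s (Ico_subset_Icc_self hs)).mono_of_mem_nhdsWithin
      (Icc_mem_nhdsGE_of_mem hs)) t ht
  simp only [hY0, mul_zero, neg_zero, Real.exp_zero, mul_one, ContinuousLinearMap.det_prod_real,
    ContinuousLinearMap.id_apply, sub_zero, one_mul] at hconst ⊢
  rw [← hconst, mul_left_comm, ← Real.exp_add]
  simp

end Meridional

/-! ### Evolution of the weighted area under the meridional flow. -/

section MeridionalFlow

open Set

variable {γ : ℝ} {U : E3 → E3} {φ : ℝ → ℝ × ℝ → ℝ × ℝ}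

/-- The mirror image of an orbit is an orbit; if it starts on the axis the two share their initial
point, hence coincide. -/
theorem IsFlow.fst_eq_zero (hφ : IsFlow (meridionalField γ U) φ) (hU : ContDiff ℝ 1 U)
    (haxi : IsAxisymmetric U) {x : ℝ × ℝ} (hx : x.1 = 0) (t : ℝ) : (φ t x).1 = 0 := by
  have hc : ∀ t, HasDerivAt (fun s => (-(φ s x).1, (φ s x).2))
      (meridionalField γ U (-(φ t x).1, (φ t x).2)) t := fun t => by
    rw [haxi.meridionalField_reflect]
    have h := hφ.hasDerivAt t x
    exact ((ContinuousLinearMap.fst ℝ ℝ ℝ).hasFDerivAt.comp_hasDerivAt t h).neg.prodMk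
      ((ContinuousLinearMap.snd ℝ ℝ ℝ).hasFDerivAt.comp_hasDerivAt t h)
  have h := hφ.eq_of_hasDerivAt (contDiff_meridionalField γ hU) hc t
  have hx' : (-(φ 0 x).1, (φ 0 x).2) = x := by
    rw [hφ.init]
    ext <;> simp [hx]
  rw [hx'] at h
  have := congrArg Prod.fst h
  simp only at this
  linarith

/-- An orbit leaving `{r > 0}` would meet the axis by the intermediate value theorem; flowing back
from there never leaves the axis. -/
theorem IsFlow.fst_pos (hφ : IsFlow (meridionalField γ U) φ) (hU : ContDiff ℝ 1 U)
    (haxi : IsAxisymmetric U) {x : ℝ × ℝ} (hx : 0 < x.1) (t : ℝ) : 0 < (φ t x).1 := by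
  by_contra! ht
  have hcont : Continuous fun s => (φ s x).1 := continuous_fst.comp (hφ.continuous_time x)
  have h0 : 0 < (φ 0 x).1 := by rwa [hφ.init]
  obtain ⟨s, hs⟩ := mem_range_of_exists_le_of_exists_ge hcont ⟨t, ht⟩ ⟨0, h0.le⟩
  have := hφ.fst_eq_zero hU haxi hs (-s)
  rw [hφ.neg_apply_self (contDiff_meridionalField γ hU)] at this
  exact hx.ne' this

theorem IsFlow.isMeridionalTrajectory (hφ : IsFlow (meridionalField γ U) φ) (hU : ContDiff ℝ 1 U)
    (haxi : IsAxisymmetric U) {x : ℝ × ℝ} (hx : 0 < x.1) :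
    IsMeridionalTrajectory γ U fun t => φ t x :=
  ⟨fun t => (hφ.fst_pos hU haxi hx t).le, fun t => hφ.hasDerivAt t x⟩

theorem IsMeridionalTrajectory.eq_flow {c : ℝ → ℝ × ℝ} (hc : IsMeridionalTrajectory γ U c)
    (hφ : IsFlow (meridionalField γ U) φ) (hU : ContDiff ℝ 1 U) (t : ℝ) : c t = φ t (c 0) :=
  hφ.eq_of_hasDerivAt (contDiff_meridionalField γ hU) hc.2 t

theorem IsFlow.advect_eq (hφ : IsFlow (meridionalField γ U) φ) (hU : ContDiff ℝ 1 U)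
    (haxi : IsAxisymmetric U) {D : Set (ℝ × ℝ)} (hD : D ⊆ openHalfPlane) (t : ℝ) :
    advect γ U D t = φ t '' D := by
  ext q
  constructor
  · rintro ⟨c, hc, h0, rfl⟩
    exact ⟨c 0, h0, (hc.eq_flow hφ hU t).symm⟩
  · rintro ⟨x, hx, rfl⟩
    exact ⟨fun t => φ t x, hφ.isMeridionalTrajectory hU haxi (hD hx), by simpa [hφ.init] using hx, rfl⟩

theorem IsFlow.image_subset_openHalfPlane (hφ : IsFlow (meridionalField γ U) φ)
    (hU : ContDiff ℝ 1 U) (haxi : IsAxisymmetric U) {D : Set (ℝ × ℝ)} (hD : D ⊆ openHalfPlane)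
    (t : ℝ) : φ t '' D ⊆ openHalfPlane := by
  rintro _ ⟨x, hx, rfl⟩
  exact hφ.fst_pos hU haxi (hD hx) t

/-- Change of variables: the Jacobian identity is exactly what turns the weight at `φ t x` into `exp
(3γt)` times the weight at `x`. It also shows that the determinant is positive. The time `δ` is
uniform over all `D` in the ball of radius `M`. -/
theorem IsFlow.exists_weightedArea_image (hφ : IsFlow (meridionalField γ U) φ)
    (hU : ContDiff ℝ 1 U) (haxi : IsAxisymmetric U) (hdiv : IsDivergenceFree U)
    (hsub : IsSublinear U) (M : ℝ) :
    ∃ δ > 0, ∀ D : Set (ℝ × ℝ), IsOpen D → D ⊆ openHalfPlane → (∀ x ∈ D, ‖x‖ ≤ M) →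
      ∀ t ∈ Icc 0 δ, weightedArea (φ t '' D) = Real.exp (3 * γ * t) * weightedArea D := by
  have hV := contDiff_meridionalField γ hU
  obtain ⟨δ, hδ, h⟩ := hφ.exists_hasFDerivAt hV
    (hasLinearGrowth_meridionalField γ hU.continuous hsub) M
  refine ⟨δ, hδ, fun D hDo hDs hDM t ht => ?_⟩
  have key : ∀ x ∈ D, ∃ A : ℝ × ℝ →L[ℝ] ℝ × ℝ, HasFDerivAt (φ t) A x ∧
      |A.det| * (φ t x).1 = Real.exp (3 * γ * t) * x.1 := by
    intro x hx
    obtain ⟨Y, hY0, hY⟩ := h x (hDM x hx)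
    refine ⟨Y t, (hY t ht).2, ?_⟩
    have hpos := hφ.fst_pos hU haxi (hDs hx)
    have hdet := det_mul_weight_eq (A := fun s => fderiv ℝ (meridionalField γ U) (φ s x))
      (R := fun s => (φ s x).1) (R' := fun s => (meridionalField γ U (φ s x)).1) (κ := 3 * γ)
      hY0 (fun s hs => (hY s hs).1)
      (fun s => (ContinuousLinearMap.fst ℝ ℝ ℝ).hasFDerivAt.comp_hasDerivAt s (hφ.hasDerivAt s x))
      (fun s => by
        rw [fderiv_meridionalField γ hU]
        exact hdiv.meridionalFDeriv_trace haxi hU γ (hpos s)) t ht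
    simp only [hφ.init] at hdet
    have hx0 : 0 < x.1 := hDs hx
    have : 0 < (Y t).det * (φ t x).1 := by rw [hdet]; positivity
    rw [abs_of_pos (pos_of_mul_pos_left this (hpos t).le), hdet]
  choose! A hA hdet using key
  rw [weightedArea, integral_image_eq_integral_abs_det_fderiv_smul volume hDo.measurableSet
    (fun x hx => (hA x hx).hasFDerivWithinAt) (hφ.injective hV t).injOn, weightedArea,
    ← integral_const_mul]
  exact setIntegral_congr_fun hDo.measurableSet hdet

theorem IsFlow.isBounded_image (hφ : IsFlow (meridionalField γ U) φ) (hU : ContDiff ℝ 1 U)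
    (hsub : IsSublinear U) {D : Set (ℝ × ℝ)} (hD : Bornology.IsBounded D) (t : ℝ) :
    Bornology.IsBounded (φ t '' D) :=
  (hD.isCompact_closure.image (hφ.continuous (contDiff_meridionalField γ hU)
    (hasLinearGrowth_meridionalField γ hU.continuous hsub) t)).isBounded.subset
      (image_mono subset_closure)

theorem IsFlow.weightedArea_image_of_nonneg (hφ : IsFlow (meridionalField γ U) φ)
    (hU : ContDiff ℝ 1 U) (haxi : IsAxisymmetric U) (hdiv : IsDivergenceFree U)
    (hsub : IsSublinear U) {D : Set (ℝ × ℝ)} (hDo : IsOpen D) (hDb : Bornology.IsBounded D)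
    (hDs : D ⊆ openHalfPlane) {t : ℝ} (ht : 0 ≤ t) :
    weightedArea (φ t '' D) = Real.exp (3 * γ * t) * weightedArea D := by
  have hV := contDiff_meridionalField γ hU
  have hg := hasLinearGrowth_meridionalField γ hU.continuous hsub
  obtain ⟨M, hM⟩ := hDb.exists_norm_le
  -- All images of `D` up to time `t` lie in one ball, so a single `δ` serves every step when `[0,
  -- t]` is cut into `n + 1` equal pieces.
  obtain ⟨ρ, hρ⟩ := hφ.exists_norm_le hg M t
  obtain ⟨δ, hδ, h⟩ := hφ.exists_weightedArea_image hU haxi hdiv hsub ρ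
  obtain ⟨n, hn⟩ := exists_nat_ge (t / δ)
  have hn1 : t / (n + 1) ≤ δ := by
    rw [div_le_iff₀ (by positivity)]
    rw [div_le_iff₀ hδ] at hn
    nlinarith
  have hs0 : 0 ≤ t / (n + 1) := by positivity
  have hst : (n + 1) * (t / (n + 1)) = t := by field_simp
  have step : ∀ k : ℕ, k ≤ n + 1 → weightedArea (φ (k * (t / (n + 1))) '' D) =
      Real.exp (3 * γ * (k * (t / (n + 1)))) * weightedArea D := by
    intro k
    induction k with
    | zero =>
      intro _
      have : φ 0 = id := funext hφ.init
      simp [this]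
    | succ k ih =>
      intro hk
      have hkt : k * (t / (n + 1)) ≤ t :=
        (mul_le_mul_of_nonneg_right (by exact_mod_cast (Nat.le_succ k).trans hk) hs0).trans_eq hst
      have himg : φ ((k + 1 : ℕ) * (t / (n + 1))) '' D =
          φ (t / (n + 1)) '' (φ (k * (t / (n + 1))) '' D) := by
        rw [image_image]
        refine image_congr fun x _ => ?_
        rw [← hφ.add hV]
        push_cast
        ring_nf
      rw [himg, h _ (hφ.isOpen_image hV hg _ hDo)
        (hφ.image_subset_openHalfPlane hU haxi hDs _) ?_ _ ⟨hs0, hn1⟩,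
        ih ((Nat.le_succ k).trans hk), ← mul_assoc, ← Real.exp_add]
      · push_cast
        ring_nf
      · rintro _ ⟨x, hx, rfl⟩
        exact hρ x (hM x hx) _ ⟨by positivity, hkt⟩
  have := step (n + 1) le_rfl
  push_cast at this
  rwa [hst] at this

theorem IsFlow.weightedArea_image (hφ : IsFlow (meridionalField γ U) φ)
    (hU : ContDiff ℝ 1 U) (haxi : IsAxisymmetric U) (hdiv : IsDivergenceFree U)
    (hsub : IsSublinear U) {D : Set (ℝ × ℝ)} (hDo : IsOpen D) (hDb : Bornology.IsBounded D)
    (hDs : D ⊆ openHalfPlane) (t : ℝ) :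
    weightedArea (φ t '' D) = Real.exp (3 * γ * t) * weightedArea D := by
  have hV := contDiff_meridionalField γ hU
  have hg := hasLinearGrowth_meridionalField γ hU.continuous hsub
  rcases le_total 0 t with ht | ht
  · exact hφ.weightedArea_image_of_nonneg hU haxi hdiv hsub hDo hDb hDs ht
  -- For negative `t`, flow the image forward by `-t`, which returns `D`.
  · have h := hφ.weightedArea_image_of_nonneg hU haxi hdiv hsub (hφ.isOpen_image hV hg t hDo)
      (hφ.isBounded_image hU hsub hDb t) (hφ.image_subset_openHalfPlane hU haxi hDs t)
      (neg_nonneg.2 ht)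
    simp only [image_image, hφ.neg_apply_self hV, image_id'] at h
    rw [h, ← mul_assoc, ← Real.exp_add]
    simp

theorem exists_isFlow_meridionalField (γ : ℝ) (hU : ContDiff ℝ 1 U) (hsub : IsSublinear U) :
    ∃ φ, IsFlow (meridionalField γ U) φ :=
  exists_isFlow (contDiff_meridionalField γ hU)
    (hasLinearGrowth_meridionalField γ hU.continuous hsub)

theorem weightedArea_advect (hU : ContDiff ℝ 1 U) (haxi : IsAxisymmetric U)
    (hdiv : IsDivergenceFree U) (hsub : IsSublinear U) {D : Set (ℝ × ℝ)} (hDo : IsOpen D)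
    (hDb : Bornology.IsBounded D) (hDs : D ⊆ openHalfPlane) (t : ℝ) :
    weightedArea (advect γ U D t) = Real.exp (3 * γ * t) * weightedArea D := by
  obtain ⟨φ, hφ⟩ := exists_isFlow_meridionalField γ hU hsub
  rw [hφ.advect_eq hU haxi hDs, hφ.weightedArea_image hU haxi hdiv hsub hDo hDb hDs]

theorem hasDerivAt_weightedArea_advect (hU : ContDiff ℝ 1 U) (haxi : IsAxisymmetric U)
    (hdiv : IsDivergenceFree U) (hsub : IsSublinear U) {D : Set (ℝ × ℝ)} (hDo : IsOpen D)
    (hDb : Bornology.IsBounded D) (hDs : D ⊆ openHalfPlane) (t : ℝ) :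
    HasDerivAt (fun s => weightedArea (advect γ U D s))
      (3 * γ * weightedArea (advect γ U D t)) t := by
  simp only [weightedArea_advect hU haxi hdiv hsub hDo hDb hDs]
  have h : HasDerivAt (fun s : ℝ => 3 * γ * s) (3 * γ) t := by
    simpa using (hasDerivAt_id t).const_mul (3 * γ)
  exact (h.exp.mul_const (weightedArea D)).congr_deriv (by ring)

theorem not_isFlowInvariant (hγ : 0 < γ) (hU : ContDiff ℝ 1 U) (haxi : IsAxisymmetric U)
    (hdiv : IsDivergenceFree U) (hsub : IsSublinear U) {D : Set (ℝ × ℝ)} (hDo : IsOpen D)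
    (hDb : Bornology.IsBounded D) (hDs : D ⊆ openHalfPlane) (hD : 0 < weightedArea D) :
    ¬ IsFlowInvariant γ U D := by
  intro hinv
  have h := weightedArea_advect hU haxi hdiv hsub hDo hDb hDs (γ := γ) 1
  rw [hinv 1] at h
  have : 1 < Real.exp (3 * γ * 1) := Real.one_lt_exp_iff.2 (by positivity)
  nlinarith

theorem weightedArea_pos {D : Set (ℝ × ℝ)} (hDo : IsOpen D) (hDb : Bornology.IsBounded D)
    (hDs : D ⊆ openHalfPlane) (hne : D.Nonempty) : 0 < weightedArea D := by
  rw [weightedArea, setIntegral_pos_iff_support_of_nonneg_ae]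
  · have : Function.support (fun p : ℝ × ℝ => p.1) ∩ D = D :=
      inter_eq_right.2 fun p hp => (hDs hp).ne'
    rw [this]
    exact hDo.measure_pos volume hne
  · exact (ae_restrict_iff' hDo.measurableSet).2 (ae_of_all _ fun p hp => (hDs hp).le)
  · exact (continuous_fst.continuousOn.integrableOn_compact hDb.isCompact_closure).mono_set
      subset_closure

end MeridionalFlow

/-! ### Separation of the half-plane by a curve, through continuous logarithms. -/

section Separation

open Set

namespace Complex

theorem eqOn_of_exp_eqOn {X : Type*} [TopologicalSpace X] {s : Set X} (hs : IsPreconnected s)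
    {f g : X → ℂ} (hf : ContinuousOn f s) (hg : ContinuousOn g s)
    (h : ∀ x ∈ s, exp (f x) = exp (g x)) {a : X} (ha : a ∈ s) (hfg : f a = g a) : EqOn f g s :=
  isCoveringMap_exp.eqOn_of_comp_eqOn hs hf hg (fun x hx => Subtype.ext (h x hx)) ha hfg

/-- Two continuous logarithms of one function differ by a constant on a preconnected set, so their
increments agree. -/
theorem sub_eq_sub_of_exp_eqOn {X : Type*} [TopologicalSpace X] {s : Set X}
    (hs : IsPreconnected s) {f g : X → ℂ} (hf : ContinuousOn f s) (hg : ContinuousOn g s)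
    (h : ∀ x ∈ s, exp (f x) = exp (g x)) {a b : X} (ha : a ∈ s) (hb : b ∈ s) :
    f a - f b = g a - g b := by
  have := eqOn_of_exp_eqOn hs hf (hg.add (continuousOn_const (c := f b - g b)))
    (fun x hx => by simp [exp_add, exp_sub, h x hx, h b hb, exp_ne_zero]) hb (by simp) ha
  simp only [Pi.add_apply] at this
  rw [this]; ring

/-- The two sides of a transversal crossing of a curve, both of whose ends go to the imaginary
axis, are not joined in the complement of the curve in the right half-plane. -/
theorem not_joinedIn_of_crossing {c : ℝ → ℂ} {v : ℂ} {δ : ℝ} (hc : Continuous c)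
    (hder : HasDerivAt c v 0) (hv : v ≠ 0) (hδ : 0 < δ)
    (hcross : ∀ τ ≠ 0, ∀ s : ℝ, |s| ≤ δ → c τ ≠ c 0 + s * (I * v))
    (htop : Tendsto (fun τ => (c τ).re) atTop (𝓝 0))
    (hbot : Tendsto (fun τ => (c τ).re) atBot (𝓝 0)) :
    ¬ JoinedIn {z | 0 < z.re ∧ z ∉ range c} (c 0 + δ * (I * v)) (c 0 - δ * (I * v)) := by
  intro hjoin
  set wp := c 0 + δ * (I * v) with hwp
  set wm := c 0 - δ * (I * v) with hwm
  obtain ⟨p, hp⟩ := hjoin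
  set η : ℝ → ℂ := fun s => p.extend s with hη
  have hηc : Continuous η := p.extend.continuous
  have hη0 : η 0 = wp := p.extend_zero
  have hη1 : η 1 = wm := p.extend_one
  have hηmem : ∀ s, 0 < (η s).re ∧ η s ∉ range c := fun s => hp _
  have hne : ∀ s τ, η s - c τ ≠ 0 := fun s τ h =>
    (hηmem s).2 ⟨τ, (sub_eq_zero.1 h).symm⟩
  -- The plane is simply connected and the path `η` misses the curve, so `η s - c τ` has a
  -- continuous logarithm in both variables.
  obtain ⟨G, hGc, hG⟩ := exists_continuousOn_eqOn_exp_comp (X := ℝ × ℝ) (U := univ)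
    ((Homeomorph.Set.univ (ℝ × ℝ)).toHomotopyEquiv.simplyConnectedSpace_iff.2 inferInstance) isOpen_univ
    (g := fun x => η x.1 - c x.2) (by fun_prop) (by rintro ⟨x, -, hx⟩; exact hne _ _ hx)
  rw [continuousOn_univ] at hGc
  replace hG : ∀ s τ, exp (G (s, τ)) = η s - c τ := fun s τ => hG (mem_univ (s, τ))
  -- The imaginary part of `f τ` is the angle swept by `η` as seen from `c τ`. The contradiction
  -- comes from its continuity at `τ = 0`.
  set f : ℝ → ℂ := fun τ => G (1, τ) - G (0, τ) with hf
  have hfc : Continuous f := by fun_prop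
  set q : ℝ → ℂ := fun τ => (wm - c τ) / (wp - c τ) with hq
  have hqd : ∀ τ, wp - c τ ≠ 0 := fun τ => hη0 ▸ hne 0 τ
  have hqc : Continuous q := Continuous.div (by fun_prop) (by fun_prop) hqd
  have hfq : ∀ τ, exp (f τ) = q τ := fun τ => by
    simp only [hf, hq, exp_sub, hG, hη0, hη1]
  -- `q τ = -t` with `t ≥ 0` places `c τ` on the segment from `wm` to `wp`, at parameter `(t - 1) /
  -- (t + 1) * δ`; only `τ = 0` is allowed there.
  have hslit : ∀ τ ≠ 0, q τ ∈ slitPlane := by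
    intro τ hτ
    by_contra hcon
    rw [mem_slitPlane_iff_not_le_zero, not_not, le_def] at hcon
    set t : ℝ := -(q τ).re with ht
    have ht0 : 0 ≤ t := by simpa [ht] using hcon.1
    have hqt : q τ = -(t : ℂ) := by
      apply ext
      · simp [ht]
      · simpa using hcon.2
    have h1 : (t : ℂ) + 1 ≠ 0 := by
      have : (t : ℝ) + 1 ≠ 0 := by positivity
      exact_mod_cast this
    have h2 : wm - c τ = -(t : ℂ) * (wp - c τ) := by
      rw [← hqt, hq, div_mul_cancel₀ _ (hqd τ)]
    refine hcross τ hτ ((t - 1) / (t + 1) * δ) ?_ ?_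
    · rw [abs_mul, abs_of_pos hδ]
      refine mul_le_of_le_one_left hδ.le ?_
      rw [abs_div, abs_of_pos (by positivity : 0 < t + 1), div_le_one (by positivity), abs_le]
      constructor <;> linarith
    · push_cast
      field_simp
      rw [hwm, hwp] at h2
      linear_combination -h2
  -- If `c τ` lies to the left of the whole path, every `η s - c τ` is in the right half-plane, so
  -- the swept angle is below `π` and `f` is the principal logarithm.
  have hfar : ∀ τ, (∀ s ∈ Icc (0 : ℝ) 1, (c τ).re < (η s).re) → f τ = log (q τ) := by
    intro τ hτ
    have hre : ∀ s ∈ Icc (0 : ℝ) 1, 0 < (η s - c τ).re := fun s hs => by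
      simpa using hτ s hs
    have h1 : f τ = log (η 1 - c τ) - log (η 0 - c τ) :=
      sub_eq_sub_of_exp_eqOn (s := Icc (0 : ℝ) 1) isPreconnected_Icc
        (f := fun s => G (s, τ)) (g := fun s => log (η s - c τ)) (by fun_prop)
        (ContinuousOn.clog (by fun_prop) fun s hs => Or.inl (hre s hs))
        (fun s _ => by rw [hG, exp_log (hne s τ)]) (right_mem_Icc.2 zero_le_one)
        (left_mem_Icc.2 zero_le_one)
    have ha := abs_lt.1 (abs_arg_lt_pi_div_two_iff.2 (Or.inl (hre 1 (by simp))))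
    have hb := abs_lt.1 (abs_arg_lt_pi_div_two_iff.2 (Or.inl (hre 0 (by simp))))
    rw [← hfq, log_exp]
    · rw [h1, sub_im, log_im, log_im]; linarith
    · rw [h1, sub_im, log_im, log_im]; linarith
  obtain ⟨s₀, -, hs₀⟩ := isCompact_Icc.exists_isMinOn (nonempty_Icc.2 (zero_le_one' ℝ))
    ((continuous_re.comp hηc).continuousOn)
  -- Far out in time the curve is near the imaginary axis, left of the compact path; connectedness
  -- spreads the equality with the principal logarithm to each half-line.
  have hlog : ∀ s : Set ℝ, IsPreconnected s → (0 : ℝ) ∉ s →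
      (∃ a ∈ s, (c a).re < (η s₀).re) → EqOn f (fun τ => log (q τ)) s := by
    rintro s hs h0 ⟨a, has, ha⟩
    have hs0 : ∀ τ ∈ s, τ ≠ 0 := fun τ hτ h => h0 (h ▸ hτ)
    refine eqOn_of_exp_eqOn hs hfc.continuousOn
      (hqc.continuousOn.clog fun τ hτ => hslit τ (hs0 τ hτ)) (fun τ hτ => ?_) has
      (hfar a fun s hs => ha.trans_le (hs₀ hs))
    rw [hfq, exp_log (slitPlane_ne_zero (hslit τ (hs0 τ hτ)))]
  have hpos := hlog (Ioi 0) isPreconnected_Ioi (by simp) (by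
    obtain ⟨a, ha, ha'⟩ := ((htop.eventually_lt_const (hηmem s₀).1).and
      (eventually_gt_atTop 0)).exists
    exact ⟨a, ha', ha⟩)
  have hneg := hlog (Iio 0) isPreconnected_Iio (by simp) (by
    obtain ⟨a, ha, ha'⟩ := ((hbot.eventually_lt_const (hηmem s₀).1).and
      (eventually_lt_atBot 0)).exists
    exact ⟨a, ha', ha⟩)
  have hδ' : (δ : ℂ) ≠ 0 := by exact_mod_cast hδ.ne'
  have hq0 : q 0 = -1 := by
    have h : wm - c 0 = -(wp - c 0) := by rw [hwm, hwp]; ring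
    simp only [hq]
    rw [h, neg_div, div_self (hqd 0)]
  -- So `q` crosses the cut upwards at `-1`. The argument of `q` is nonnegative just after time 0
  -- and negative just before, which forces `(f 0).im = 0` and contradicts `exp (f 0) = -1`.
  have hqder : HasDerivAt q (2 / δ * I) 0 := by
    refine ((hder.const_sub wm).div (hder.const_sub wp) (hqd 0)).congr_deriv ?_
    simp only [hwm, hwp]
    have : (δ : ℂ) * (I * v) ≠ 0 := by simp [hδ', hv]
    rw [add_sub_cancel_left]
    field_simp
    ring_nf
    simp
  have him : HasDerivAt (fun τ => (q τ).im) (2 / δ) 0 := by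
    have := imCLM.hasFDerivAt.comp_hasDerivAt (0 : ℝ) hqder
    simpa [Function.comp_def] using this
  have hslope := (hasDerivAt_iff_tendsto_slope.1 him).eventually_const_lt
    (by positivity : 0 < 2 / δ)
  have hf1 : 0 ≤ (f 0).im := by
    refine ge_of_tendsto (((continuous_im.comp hfc).tendsto 0).mono_left
      (nhdsWithin_le_nhds (s := Ioi 0))) ?_
    filter_upwards [nhdsWithin_mono (0 : ℝ) (fun x (hx : 0 < x) => hx.ne') hslope,
      self_mem_nhdsWithin] with τ h1 hτ
    simp only [slope_def_field, hq0, neg_im, one_im, neg_zero, sub_zero] at h1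
    have : 0 < (q τ).im := by rwa [div_pos_iff_of_pos_right hτ] at h1
    simp only [Function.comp, hpos hτ, log_im]
    exact arg_nonneg_iff.2 this.le
  have hf2 : (f 0).im ≤ 0 := by
    refine le_of_tendsto (((continuous_im.comp hfc).tendsto 0).mono_left
      (nhdsWithin_le_nhds (s := Iio 0))) ?_
    filter_upwards [nhdsWithin_mono (0 : ℝ) (fun x (hx : x < 0) => hx.ne) hslope,
      self_mem_nhdsWithin] with τ h1 hτ
    simp only [slope_def_field, hq0, neg_im, one_im, neg_zero, sub_zero] at h1
    have : (q τ).im < 0 := by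
      have hτ' : τ < 0 := hτ
      by_contra! h
      exact absurd h1 (not_lt.2 (div_nonpos_of_nonneg_of_nonpos h hτ'.le))
    simp only [Function.comp, hneg hτ, log_im]
    exact (arg_neg_iff.2 this).le
  have h0 := congrArg re (hfq 0)
  rw [exp_re, le_antisymm hf2 hf1, hq0] at h0
  simp at h0
  linarith [Real.exp_pos (f 0).re]

end Complex

end Separation

/-! ### The bounded region cut off by a curve with both ends on the axis. -/

section Orbit

open Set

variable {c : ℝ → ℝ × ℝ} {v : ℝ × ℝ}

theorem not_joinedIn_of_crossing {δ : ℝ} (hc : Continuous c) (hder : HasDerivAt c v 0)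
    (hv : v ≠ 0) (hδ : 0 < δ)
    (hcross : ∀ τ ≠ 0, ∀ s : ℝ, |s| ≤ δ → c τ ≠ c 0 + s • (-v.2, v.1))
    (htop : Tendsto (fun τ => (c τ).1) atTop (𝓝 0))
    (hbot : Tendsto (fun τ => (c τ).1) atBot (𝓝 0)) :
    ¬ JoinedIn (openHalfPlane \ range c) (c 0 + δ • (-v.2, v.1)) (c 0 - δ • (-v.2, v.1)) := by
  intro hjoin
  set e : (ℝ × ℝ) ≃L[ℝ] ℂ := Complex.equivRealProdCLM.symm with he
  have hre : ∀ x, (e x).re = x.1 := fun x => by simp [he]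
  have hJ : e (-v.2, v.1) = Complex.I * e v := by
    apply Complex.ext <;> simp [he]
  refine Complex.not_joinedIn_of_crossing (c := fun τ => e (c τ)) (v := e v) (δ := δ)
    (e.continuous.comp hc) (e.hasFDerivAt.comp_hasDerivAt 0 hder) (by simpa using hv) hδ ?_
    (by simpa only [hre] using htop) (by simpa only [hre] using hbot) ?_
  · intro τ hτ s hs h
    refine hcross τ hτ s hs (e.injective ?_)
    rw [h, map_add, map_smul, hJ, Complex.real_smul]
  · have := hjoin.map_continuousOn (f := e) e.continuous.continuousOn
    rw [map_add, map_sub, map_smul, hJ, Complex.real_smul] at this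
    refine this.mono ?_
    rintro _ ⟨x, ⟨hx, hxc⟩, rfl⟩
    refine ⟨by rw [hre]; exact hx, ?_⟩
    rintro ⟨τ, hτ⟩
    exact hxc ⟨τ, e.injective hτ⟩

/-- The curve can accumulate at its ends only on the axis: near a point with `r > 0` only a compact
time interval matters. -/
theorem isClosed_union_image (hc : Continuous c)
    (htop : Tendsto (fun τ => (c τ).1) atTop (𝓝 0))
    (hbot : Tendsto (fun τ => (c τ).1) atBot (𝓝 0)) {S : Set ℝ} (hS : IsClosed S) :
    IsClosed ({p : ℝ × ℝ | p.1 ≤ 0} ∪ c '' S) := by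
  rw [← isOpen_compl_iff, isOpen_iff_mem_nhds]
  intro x hx
  rw [mem_compl_iff, mem_union, not_or, mem_ofPred, not_le] at hx
  obtain ⟨a, ha⟩ := eventually_atTop.1 (htop.eventually_lt_const (half_pos hx.1))
  obtain ⟨b, hb⟩ := eventually_atBot.1 (hbot.eventually_lt_const (half_pos hx.1))
  have hK : IsClosed (c '' (S ∩ Icc b a)) :=
    ((isCompact_Icc.inter_left hS).image hc).isClosed
  filter_upwards [hK.isOpen_compl.mem_nhds fun h => hx.2 (image_mono inter_subset_left h),
    (isOpen_lt continuous_const continuous_fst).mem_nhds (half_lt_self hx.1)] with y hy1 hy2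
  rintro (hy | ⟨τ, hτ, rfl⟩)
  · have h1 : y.1 ≤ 0 := hy
    have h2 : x.1 / 2 < y.1 := hy2
    linarith [hx.1]
  · have h2 : x.1 / 2 < (c τ).1 := hy2
    refine hy1 ⟨τ, ⟨hτ, ?_, ?_⟩, rfl⟩
    · by_contra! h
      exact absurd (hb τ h.le) (not_lt.2 h2.le)
    · by_contra! h
      exact absurd (ha τ h.le) (not_lt.2 h2.le)

/-- A simple curve is crossed only once by short normal segments. -/
theorem exists_normal_segment (hc : Continuous c) (hder : HasDerivAt c v 0) (hv : v ≠ 0)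
    (hpos : ∀ τ, 0 < (c τ).1) (hinj : ∀ τ ≠ 0, c τ ≠ c 0)
    (htop : Tendsto (fun τ => (c τ).1) atTop (𝓝 0))
    (hbot : Tendsto (fun τ => (c τ).1) atBot (𝓝 0)) :
    ∃ δ > 0, ∀ s : ℝ, |s| ≤ δ → 0 < (c 0 + s • (-v.2, v.1)).1 ∧
      ∀ τ ≠ 0, c τ ≠ c 0 + s • (-v.2, v.1) := by
  have hg : HasDerivAt (fun τ => (c τ).1 * v.1 + (c τ).2 * v.2) (v.1 * v.1 + v.2 * v.2) 0 :=
    (((ContinuousLinearMap.fst ℝ ℝ ℝ).hasFDerivAt.comp_hasDerivAt 0 hder).mul_const v.1).fun_add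
      (((ContinuousLinearMap.snd ℝ ℝ ℝ).hasFDerivAt.comp_hasDerivAt 0 hder).mul_const v.2)
  have hv2 : v.1 * v.1 + v.2 * v.2 ≠ 0 := by
    intro h
    rw [mul_self_add_mul_self_eq_zero] at h
    exact hv (Prod.ext h.1 h.2)
  -- For small `τ ≠ 0` the component of `c τ` along `v` differs from that of `c 0`, whereas it is
  -- constant on the normal segment. For `ε ≤ |τ|`, closedness keeps the curve away from `c 0`.
  have hev := hg.eventually_ne hv2 (c := (c 0).1 * v.1 + (c 0).2 * v.2)
  rw [eventually_nhdsWithin_iff, Metric.eventually_nhds_iff] at hev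
  obtain ⟨ε, hε, hev⟩ := hev
  have hclosed := isClosed_union_image hc htop hbot (S := {τ | ε ≤ |τ|})
    (isClosed_le continuous_const continuous_abs)
  have hmem : c 0 ∈ ({p : ℝ × ℝ | p.1 ≤ 0} ∪ c '' {τ | ε ≤ |τ|})ᶜ := by
    rintro (h | ⟨τ, hτ, h⟩)
    · exact (hpos 0).not_ge h
    · refine hinj τ ?_ h
      rintro rfl
      simp only [mem_ofPred, abs_zero] at hτ
      exact hτ.not_gt hε
  have hlim : Tendsto (fun s : ℝ => c 0 + s • (-v.2, v.1)) (𝓝 0) (𝓝 (c 0)) := by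
    have : Continuous fun s : ℝ => c 0 + s • (-v.2, v.1) := by fun_prop
    simpa using this.tendsto 0
  obtain ⟨δ, hδ, h⟩ := Metric.eventually_nhds_iff.1
    (hlim.eventually (hclosed.isOpen_compl.mem_nhds hmem))
  refine ⟨δ / 2, half_pos hδ, fun s hs => ?_⟩
  have hs' := h (y := s) (by rw [Real.dist_0_eq_abs]; linarith)
  rw [mem_union, not_or, mem_ofPred, not_le] at hs'
  refine ⟨hs'.1, fun τ hτ heq => ?_⟩
  by_cases hτε : ε ≤ |τ|
  · exact hs'.2 ⟨τ, hτε, heq⟩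
  · refine hev (y := τ) (by rw [Real.dist_0_eq_abs]; exact not_le.1 hτε) hτ ?_
    rw [heq]
    simp
    ring

/-- The region is a union of three overlapping products of intervals. It serves as the neighbourhood
of infinity in the half-plane, out of reach of a curve bounded by `M`. -/
theorem isPreconnected_halfPlane_diff_box {M : ℝ} (hM : 0 ≤ M) :
    IsPreconnected {p : ℝ × ℝ | 0 < p.1 ∧ (M < p.1 ∨ M < p.2 ∨ p.2 < -M)} := by
  have h1 : IsPreconnected (Ioi M ×ˢ univ : Set (ℝ × ℝ)) :=
    isPreconnected_Ioi.prod isPreconnected_univ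
  have h2 : IsPreconnected (Ioi 0 ×ˢ Ioi M : Set (ℝ × ℝ)) :=
    isPreconnected_Ioi.prod isPreconnected_Ioi
  have h3 : IsPreconnected (Ioi 0 ×ˢ Iio (-M) : Set (ℝ × ℝ)) :=
    isPreconnected_Ioi.prod isPreconnected_Iio
  have h12 := h1.union (M + 1, M + 1) (by simp) (by simp; linarith) h2
  have h123 := h12.union (M + 1, -M - 1) (by simp) (by simp; linarith) h3
  convert! h123 using 1
  ext ⟨r, z⟩
  simp only [mem_ofPred, mem_union, mem_prod, mem_Ioi, mem_univ, mem_Iio, and_true]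
  constructor
  · tauto
  · rintro ((h | h) | h)
    · exact ⟨hM.trans_lt h, Or.inl h⟩
    · exact ⟨h.1, Or.inr (Or.inl h.2)⟩
    · exact ⟨h.1, Or.inr (Or.inr h.2)⟩

theorem exists_norm_le_of_tendsto (hc : Continuous c) {p q : ℝ × ℝ}
    (hbot : Tendsto c atBot (𝓝 p)) (htop : Tendsto c atTop (𝓝 q)) :
    ∃ M, 0 ≤ M ∧ ∀ τ, ‖c τ‖ ≤ M := by
  obtain ⟨a, ha⟩ := eventually_atTop.1 (htop.norm.eventually_lt_const (lt_add_one ‖q‖))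
  obtain ⟨b, hb⟩ := eventually_atBot.1 (hbot.norm.eventually_lt_const (lt_add_one ‖p‖))
  obtain ⟨C, hC⟩ := (isCompact_Icc (a := b) (b := a)).exists_bound_of_continuousOn hc.continuousOn
  refine ⟨max |C| (max (‖p‖ + 1) (‖q‖ + 1)), by positivity, fun τ => ?_⟩
  by_cases h1 : a ≤ τ
  · exact (ha τ h1).le.trans ((le_max_right _ _).trans (le_max_right _ _))
  by_cases h2 : τ ≤ b
  · exact (hb τ h2).le.trans ((le_max_left _ _).trans (le_max_right _ _))
  · exact (hC τ ⟨(not_le.1 h2).le, (not_le.1 h1).le⟩).trans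
      ((le_abs_self C).trans (le_max_left _ _))

/-- A simple curve in the half-plane whose two ends converge to points of the boundary line cuts
off a bounded component. -/
theorem exists_bounded_connectedComponentIn (hc : Continuous c) (hder : HasDerivAt c v 0)
    (hv : v ≠ 0) (hpos : ∀ τ, 0 < (c τ).1) (hinj : ∀ τ ≠ 0, c τ ≠ c 0) {p q : ℝ × ℝ}
    (hp : p.1 = 0) (hq : q.1 = 0) (hbot : Tendsto c atBot (𝓝 p)) (htop : Tendsto c atTop (𝓝 q)) :
    IsOpen (openHalfPlane \ range c) ∧ ∃ w ∈ openHalfPlane \ range c,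
      Bornology.IsBounded (connectedComponentIn (openHalfPlane \ range c) w) := by
  have htop1 : Tendsto (fun τ => (c τ).1) atTop (𝓝 0) :=
    hq ▸ (continuous_fst.tendsto q).comp htop
  have hbot1 : Tendsto (fun τ => (c τ).1) atBot (𝓝 0) :=
    hp ▸ (continuous_fst.tendsto p).comp hbot
  have hopen : IsOpen (openHalfPlane \ range c) := by
    have h := (isClosed_union_image hc htop1 hbot1 isClosed_univ).isOpen_compl
    convert! h using 1
    ext x
    simp [openHalfPlane]
  refine ⟨hopen, ?_⟩
  obtain ⟨δ, hδ, hseg⟩ := exists_normal_segment hc hder hv hpos hinj htop1 hbot1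
  set n : ℝ × ℝ := (-v.2, v.1) with hn
  have hn0 : n ≠ 0 := by
    intro h
    simp only [hn, Prod.mk_eq_zero, neg_eq_zero] at h
    exact hv (Prod.ext h.2 h.1)
  have hmem : ∀ s : ℝ, |s| ≤ δ → s ≠ 0 → c 0 + s • n ∈ openHalfPlane \ range c := by
    intro s hs hs0
    refine ⟨(hseg s hs).1, ?_⟩
    rintro ⟨τ, hτ⟩
    by_cases h : τ = 0
    · subst h
      simp [hs0, hn0] at hτ
    · exact (hseg s hs).2 τ h hτ
  have hplus := hmem δ (abs_of_pos hδ).le hδ.ne'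
  have hminus : c 0 - δ • n ∈ openHalfPlane \ range c := by
    have := hmem (-δ) (by rw [abs_neg, abs_of_pos hδ]) (neg_ne_zero.2 hδ.ne')
    rwa [neg_smul, ← sub_eq_add_neg] at this
  have hnj := not_joinedIn_of_crossing hc hder hv hδ
    (fun τ hτ s hs => (hseg s hs).2 τ hτ) htop1 hbot1
  obtain ⟨M, hM, hcM⟩ := exists_norm_le_of_tendsto hc hbot htop
  set X : Set (ℝ × ℝ) := {p | 0 < p.1 ∧ (M < p.1 ∨ M < p.2 ∨ p.2 < -M)} with hX
  have hXsub : X ⊆ openHalfPlane \ range c := by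
    rintro x ⟨hx, hx'⟩
    refine ⟨hx, ?_⟩
    rintro ⟨τ, rfl⟩
    have h := hcM τ
    rw [Prod.norm_def, max_le_iff, Real.norm_eq_abs, Real.norm_eq_abs, abs_le, abs_le] at h
    rcases hx' with h' | h' | h' <;> linarith [h.1.2, h.2.1, h.2.2]
  -- A component that misses the far region `X` lies in the box; it remains to see that one side of
  -- the crossing has this property.
  have hbdd : ∀ w, Disjoint (connectedComponentIn (openHalfPlane \ range c) w) X →
      Bornology.IsBounded (connectedComponentIn (openHalfPlane \ range c) w) := by
    intro w hw
    refine (Metric.isBounded_closedBall (x := (0 : ℝ × ℝ)) (r := M)).subset fun x hx => ?_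
    have hx0 : 0 < x.1 := (connectedComponentIn_subset _ _ hx).1
    have hxX : x ∉ X := disjoint_left.1 hw hx
    simp only [hX, mem_ofPred, not_and, not_or, not_lt] at hxX
    obtain ⟨h1, h2, h3⟩ := hxX hx0
    rw [mem_closedBall_zero_iff, Prod.norm_def]
    exact max_le (abs_le.2 ⟨by linarith, h1⟩) (abs_le.2 ⟨h3, h2⟩)
  by_cases h1 : Disjoint (connectedComponentIn (openHalfPlane \ range c) (c 0 + δ • n)) X
  · exact ⟨_, hplus, hbdd _ h1⟩
  by_cases h2 : Disjoint (connectedComponentIn (openHalfPlane \ range c) (c 0 - δ • n)) X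
  · exact ⟨_, hminus, hbdd _ h2⟩
  -- If both sides reached the connected set `X`, they would lie in one component, which is open and
  -- hence path connected, against `hnj`.
  exfalso
  obtain ⟨x, hx, hxX⟩ := not_disjoint_iff.1 h1
  obtain ⟨y, hy, hyX⟩ := not_disjoint_iff.1 h2
  have hXc := (isPreconnected_halfPlane_diff_box hM).subset_connectedComponentIn hxX hXsub
  have hxy := connectedComponentIn_eq (hXc hyX)
  have e1 := connectedComponentIn_eq hx
  have e2 := connectedComponentIn_eq hy
  have hm : c 0 - δ • n ∈ connectedComponentIn (openHalfPlane \ range c) (c 0 + δ • n) := by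
    rw [e1, hxy, ← e2]
    exact mem_connectedComponentIn hminus
  have hpc : IsPathConnected (connectedComponentIn (openHalfPlane \ range c) (c 0 + δ • n)) :=
    hopen.connectedComponentIn.isConnected_iff_isPathConnected.1
      (isConnected_connectedComponentIn_iff.2 hplus)
  exact hnj ((hpc.joinedIn _ (mem_connectedComponentIn hplus) _ hm).mono
    (connectedComponentIn_subset _ _))

/-! ### Invariance of the components and exclusion of connecting orbits. -/

variable {γ : ℝ} {U : E3 → E3}

/-- The components of the complement of an orbit are invariant. -/
theorem isFlowInvariant_connectedComponentIn (hU : ContDiff ℝ 1 U) (haxi : IsAxisymmetric U)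
    (hsub : IsSublinear U) (hc : IsMeridionalTrajectory γ U c) (w : ℝ × ℝ) :
    IsFlowInvariant γ U (connectedComponentIn (openHalfPlane \ range c) w) := by
  obtain ⟨φ, hφ⟩ := exists_isFlow_meridionalField γ hU hsub
  have hV := contDiff_meridionalField γ hU
  set D := connectedComponentIn (openHalfPlane \ range c) w with hD
  have hDs : D ⊆ openHalfPlane := (connectedComponentIn_subset _ _).trans sdiff_subset
  -- The orbit of `x` is connected, stays in `{r > 0}` and cannot touch `c`, since it would then be
  -- contained in `range c`.
  have hmem : ∀ x ∈ D, ∀ t, φ t x ∈ D := by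
    intro x hx t
    have hxΩ := connectedComponentIn_subset _ _ hx
    have hsub : range (fun t => φ t x) ⊆ openHalfPlane \ range c := by
      rintro _ ⟨s, rfl⟩
      refine ⟨hφ.fst_pos hU haxi hxΩ.1 s, ?_⟩
      rintro ⟨τ, hτ⟩
      refine hxΩ.2 ⟨-s + τ, ?_⟩
      rw [hc.eq_flow hφ hU, hφ.add hV, ← hc.eq_flow hφ hU, hτ]
      exact hφ.neg_apply_self hV s x
    have h := (isPreconnected_range (hφ.continuous_time x)).subset_connectedComponentIn
      (x := x) ⟨0, hφ.init x⟩ hsub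
    rw [hD, connectedComponentIn_eq hx]
    exact h ⟨t, rfl⟩
  intro τ
  rw [hφ.advect_eq hU haxi hDs]
  refine Subset.antisymm ?_ fun x hx => ⟨φ (-τ) x, hmem x hx _, hφ.self_apply_neg hV τ x⟩
  rintro _ ⟨x, hx, rfl⟩
  exact hmem x hx τ

theorem not_connects_of_mem_openHalfPlane (hγ : 0 < γ) (hU : ContDiff ℝ 1 U)
    (haxi : IsAxisymmetric U) (hdiv : IsDivergenceFree U) (hsub : IsSublinear U)
    (hfix : ∀ p, IsMeridionalFixedPoint γ U p → p.1 = 0) {p q : ℝ × ℝ}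
    (hconn : Connects γ U p q c) {τ₀ : ℝ} (hτ₀ : c τ₀ ∈ openHalfPlane) : False := by
  obtain ⟨hp, hq, hc, hbot, htop⟩ := hconn
  obtain ⟨φ, hφ⟩ := exists_isFlow_meridionalField γ hU hsub
  have hV := contDiff_meridionalField γ hU
  have hpos : ∀ τ, 0 < (c τ).1 := by
    intro τ
    have h : c τ = φ (τ - τ₀) (c τ₀) := by
      rw [hc.eq_flow hφ hU τ, hc.eq_flow hφ hU τ₀, ← hφ.add hV, sub_add_cancel]
    rw [h]
    exact hφ.fst_pos hU haxi hτ₀ _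
  have hcont : Continuous c := continuous_iff_continuousAt.2 fun t => (hc.2 t).continuousAt
  have hv : meridionalField γ U (c 0) ≠ 0 := fun h => (hpos 0).ne' (hfix _ ⟨hc.1 0, h⟩)
  -- A return to `c 0` would make the orbit periodic; its limit `q`, which lies on the axis, would
  -- then equal `c 0`, which does not.
  have hinj : ∀ τ ≠ 0, c τ ≠ c 0 := by
    intro τ hτ h
    have hper : Function.Periodic c τ := fun t => by
      rw [hc.eq_flow hφ hU (t + τ), hφ.add hV, ← hc.eq_flow hφ hU τ, h, ← hc.eq_flow hφ hU t]
    have hper' : Function.Periodic c |τ| := by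
      rcases abs_choice τ with h' | h' <;> rw [h']
      exacts [hper, hper.neg]
    have hseq : Tendsto (fun n : ℕ => c (n * |τ|)) atTop (𝓝 q) :=
      htop.comp (tendsto_natCast_atTop_atTop.atTop_mul_const (abs_pos.2 hτ))
    have hcst : ∀ n : ℕ, c (n * |τ|) = c 0 := fun n => by simpa using hper'.nat_mul_eq n
    simp only [hcst] at hseq
    have := tendsto_nhds_unique hseq tendsto_const_nhds
    exact (hpos 0).ne' (this ▸ hfix q hq)
  obtain ⟨hopen, w, hw, hbdd⟩ := exists_bounded_connectedComponentIn hcont (hc.2 0) hv hpos hinj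
    (hfix p hp) (hfix q hq) hbot htop
  have hDs : connectedComponentIn (openHalfPlane \ range c) w ⊆ openHalfPlane :=
    (connectedComponentIn_subset _ _).trans sdiff_subset
  exact not_isFlowInvariant hγ hU haxi hdiv hsub hopen.connectedComponentIn hbdd hDs
    (weightedArea_pos hopen.connectedComponentIn hbdd hDs ⟨w, mem_connectedComponentIn hw⟩)
    (isFlowInvariant_connectedComponentIn hU haxi hsub hc w)

end Orbit

theorem mainTheorem10 (γ : ℝ) (hγ : 0 < γ) (U : E3 → E3) (hU : ContDiff ℝ 1 U)
    (haxi : IsAxisymmetric U) (hdiv : IsDivergenceFree U) (hsub : IsSublinear U) :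
    (∀ D : Set (ℝ × ℝ), IsOpen D → Bornology.IsBounded D → D ⊆ openHalfPlane →
      (∀ τ : ℝ,
        HasDerivAt (fun s => weightedArea (advect γ U D s))
          (3 * γ * weightedArea (advect γ U D τ)) τ ∧
        weightedArea (advect γ U D τ) = Real.exp (3 * γ * τ) * weightedArea D) ∧
      (0 < weightedArea D → ¬ IsFlowInvariant γ U D)) ∧
    ((∀ p, IsMeridionalFixedPoint γ U p → p.1 = 0) →
      ¬ ∃ c : ℝ → ℝ × ℝ, (IsHeteroclinic γ U c ∨ IsHomoclinic γ U c) ∧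
        ∃ τ, c τ ∈ openHalfPlane) := by
  refine ⟨fun D hDo hDb hDs => ⟨fun τ =>
    ⟨hasDerivAt_weightedArea_advect hU haxi hdiv hsub hDo hDb hDs τ,
      weightedArea_advect hU haxi hdiv hsub hDo hDb hDs τ⟩,
    not_isFlowInvariant hγ hU haxi hdiv hsub hDo hDb hDs⟩, ?_⟩
  rintro hfix ⟨c, ⟨p, q, -, hconn⟩ | ⟨p, hconn, -⟩, τ, hτ⟩
  · exact not_connects_of_mem_openHalfPlane hγ hU haxi hdiv hsub hfix hconn hτ
  · exact not_connects_of_mem_openHalfPlane hγ hU haxi hdiv hsub hfix hconn hτ
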